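/- Let $K$ be a commutative locally compact (Hausdorff) hypergroup with convolution $(x,y)\mapsto\omega(x,y)$ (where each $\omega(x,y)=\delta_x*\delta_y$ is a regular Borel probability measure on $K$ with compact support), involution $x\mapsto\tilde x$ and unit $e$, and let $m$ be a Haar measure on $K$, i.e. a nonzero Radon measure with $\int_K T_xf\,dm=\int_K f\,dm$ for all $x\in K$, $f\in C_c(K)$, where $T_xf(y):=\int_K f\,d\omega(x,y)$. Write $L^1(K)=L^1(K,m)$ and $L^\infty(K)=L^1(K)^*$ for the spaces of complex-valued integrable, respectively essentially bounded, functions, with the convolution $f*g(x)=\int_K f(y)\,T_{\tilde y}g(x)\,dm(y)$ on $L^1(K)$. Let $$\widehat K=\{\alpha\in C^b(K):\ \alpha\neq 0,\ \textstyle\int_K\alpha\,d\omega(x,y)=\alpha(x)\alpha(y)\ \text{and}\ \alpha(\tilde x)=\overline{\alpha(x)}\ \text{for all } x,y\in K\},$$ and for $f\in L^1(K)$, $\alpha\in\widehat K$ put $\widehat f(\alpha)=\int_K\overline{\alpha(x)}f(x)\,dm(x)$. Let $\alpha\in\widehat K$. Suppose that $K$ is $\alpha$-amenable, i.e. there is a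 bounded linear functional $m_\alpha$ on $L^\infty(K)$ with $m_\alpha(\alpha)=1$ and $m_\alpha(T_xf)=\alpha(x)\,m_\alpha(f)$ for all $f\in L^\infty(K)$ and $x\in K$. Then every $\alpha$-derivation on $L^1(K)$ is zero: if $D\in L^1(K)^*$ is a bounded linear functional with $$D(f*g)=\widehat f(\alpha)\,D(g)+\widehat g(\alpha)\,D(f)\qquad\text{for all } f,g\in L^1(K),$$ then $D=0$. -/

import Mathlib

open MeasureTheory Topology
open scoped ENNReal BoundedContinuousFunction ComplexConjugate

/-- A (locally compact) hypergroup `(K, ω, ~)`: a locally compact Hausdorff space `K` together with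
a convolution `ω : K × K → M¹(K)` into the regular Borel probability measures, an involution `~`
and a unit `e`. -/
class Hypergroup (K : Type*) [TopologicalSpace K] [T2Space K] [LocallyCompactSpace K]
    [MeasurableSpace K] [BorelSpace K] where
  /-- the convolution `ω(x, y) = δ_x * δ_y` of two point measures -/
  ω : K → K → Measure K
  /-- the involution `x ↦ x̃` -/
  tilde : K → K
  /-- the unit -/
  e : K
  isProbabilityMeasure_ω : ∀ x y, IsProbabilityMeasure (ω x y)
  regular_ω : ∀ x y, (ω x y).Regular
  /-- `(x, y) ↦ ω(x, y)` is continuous for the weak topology on `M¹(K)` -/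
  continuous_ω : ∀ f : K →ᵇ ℂ, Continuous fun p : K × K => ∫ t, f t ∂(ω p.1 p.2)
  /-- associativity `ω(x, ω(y, z)) = ω(ω(x, y), z)`, tested on bounded continuous functions -/
  assoc_ω : ∀ (x y z : K) (f : K →ᵇ ℂ),
    ∫ t, (∫ s, f s ∂(ω x t)) ∂(ω y z) = ∫ t, (∫ s, f s ∂(ω t z)) ∂(ω x y)
  isCompact_support_ω : ∀ x y, IsCompact (ω x y).support
  /-- `(x, y) ↦ supp ω(x, y)` is continuous for the Michael topology on the nonempty compact
  subsets of `K`, which is generated by the sets `{A | A ⊆ U}` and `{A | A ∩ U ≠ ∅}`,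
  `U` open -/
  isOpen_support_subset : ∀ U : Set K, IsOpen U → IsOpen {p : K × K | (ω p.1 p.2).support ⊆ U}
  isOpen_support_inter : ∀ U : Set K, IsOpen U →
    IsOpen {p : K × K | ((ω p.1 p.2).support ∩ U).Nonempty}
  ω_e : ∀ x, ω x e = Measure.dirac x
  e_ω : ∀ x, ω e x = Measure.dirac x
  continuous_tilde : Continuous tilde
  tilde_tilde : ∀ x, tilde (tilde x) = x
  map_tilde_ω : ∀ x y, (ω x y).map tilde = ω (tilde y) (tilde x)
  e_mem_support_iff : ∀ x y, e ∈ (ω x y).support ↔ x = tilde y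

namespace Hypergroup

section

variable {K : Type*} [TopologicalSpace K] [T2Space K] [LocallyCompactSpace K]
  [MeasurableSpace K] [BorelSpace K] [Hypergroup K]

/-- The translate `T_x f (y) = ∫ f dω(x, y)`. -/
noncomputable def translate (x : K) (f : K → ℂ) (y : K) : ℂ := ∫ t, f t ∂(ω x y)

variable (K) in
/-- `K` is commutative. -/
def IsCommutative : Prop := ∀ x y : K, ω x y = ω y x

/-- `m` is a Haar measure on the (commutative) hypergroup `K`: a nonzero Radon measure which is
invariant under the translations `T_x`. "Radon" is taken in the form "finite on compact sets, and
inner regular by compact sets on every Borel set". For this version of the Haar measure null sets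
and locally null sets coincide, so that `Lp ℂ ∞ m` is the dual of `Lp ℂ 1 m` also if
`K` is not `σ`-compact. -/
structure IsHaarMeasure (m : Measure K) : Prop where
  ne_zero : m ≠ 0
  isFiniteMeasureOnCompacts : IsFiniteMeasureOnCompacts m
  innerRegular : m.InnerRegular
  integral_translate : ∀ (x : K) (f : K → ℂ), Continuous f → HasCompactSupport f →
    ∫ y, translate x f y ∂m = ∫ y, f y ∂m

/-- `α` belongs to the dual `K̂`: it is a nonzero bounded continuous function which is
multiplicative and hermitian. -/
structure IsCharacter (α : K →ᵇ ℂ) : Prop where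
  ne_zero : α ≠ 0
  integral_ω : ∀ x y : K, ∫ t, α t ∂(ω x y) = α x * α y
  map_tilde : ∀ x : K, α (tilde x) = conj (α x)

/-- The convolution `(f * g)(x) = ∫ f(y) T_ỹ g (x) dm(y)`. -/
noncomputable def convolution (m : Measure K) (f g : K → ℂ) (x : K) : ℂ :=
  ∫ y, f y * translate (tilde y) g x ∂m

/-- The Fourier transform `f̂(α) = ∫ conj(α(x)) f(x) dm(x)`. -/
noncomputable def fourier (m : Measure K) (f : K → ℂ) (α : K →ᵇ ℂ) : ℂ :=
  ∫ x, conj (α x) * f x ∂m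

/-- The class in `L^∞(K)` of a bounded continuous function. -/
noncomputable def toLinfty (m : Measure K) (f : K →ᵇ ℂ) : Lp ℂ ∞ m :=
  (memLp_top_of_bound f.continuous.aestronglyMeasurable ‖f‖
    (Filter.Eventually.of_forall f.norm_coe_le_norm)).toLp f

/-- `K` is `α`-amenable: there is a bounded linear functional `M` on `L^∞(K)` with `M(α) = 1` and
`M(T_x f) = α(x) M(f)` for all `f ∈ L^∞(K)` and `x ∈ K`. The element `T_x f` of `L^∞(K)` appears
as the element `g` which is almost everywhere equal to the translate of `f`. -/
def IsAmenable (m : Measure K) (α : K →ᵇ ℂ) : Prop :=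
  ∃ M : StrongDual ℂ (Lp ℂ ∞ m), M (toLinfty m α) = 1 ∧
    ∀ (x : K) (f g : Lp ℂ ∞ m), (g =ᵐ[m] translate x f) → M g = α x * M f

/-- `D ∈ L¹(K)^*` is an `α`-derivation: `D(f * g) = f̂(α) D(g) + ĝ(α) D(f)` for all
`f, g ∈ L¹(K)`. The element `f * g` of `L¹(K)` appears as the element `h` which is almost everywhere
equal to the convolution of `f` and `g`. -/
def IsDerivation (m : Measure K) (α : K →ᵇ ℂ) (D : StrongDual ℂ (Lp ℂ 1 m)) : Prop :=
  ∀ f g h : Lp ℂ 1 m, (h =ᵐ[m] convolution m f g) →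
    D h = fourier m f α * D g + fourier m g α * D f

end

end Hypergroup

/-!
Fix `g ∈ C_c(K)` with `ĝ(α) = 1` and put `φ(x) = D(T_x g) - α(x) D(g)`. From
`(T_x f) * g = f * T_x g` and `fourier (T_x f) = α(x) f̂(α)`, the derivation rule gives
`D(T_x f) = α(x) D(f) + f̂(α) φ(x)`. For `f = T_y g`, and because `D` commutes with integrals, this
says that `φ` is a bounded continuous solution of `T_x φ = α(x) φ + φ(x) α`; applying the `α`-mean
yields `φ = 0`. Integrating `D(T_x g) = α(x) D(g)` gives `D(f * g) = f̂(α) D(g)`, and comparison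
with the derivation rule leaves `D(f) = 0` for every `f ∈ C_c(K)`, a dense subspace of `L¹(K)`.

The identity `(T_x f) * g = f * T_x g` rests on the adjointness of `T_x` and `T_x̃` for `m`. By
commutativity `∫∫ g(x) f(z) T_z h(x) dm(z) dm(x)` is symmetric in `f` and `g`; as `h` runs through
an approximate identity, `∫ f(z) T_z h(x) dm(z)` tends to `f(x̃)`, and the limit gives both the
adjointness and the invariance of `m` under the involution.

The derivation rule and the mean only see classes modulo `m`-null sets `N`, so one also needs
`ω(x, y) N = 0` for almost every `y`. Invariance gives this for outer approximations of `N` once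
`y ↦ ω(x, y) U` is known to be lower semicontinuous for open `U`.
-/

open Filter
open scoped CompactlySupported NNReal

section Urysohn

variable {X : Type*} [TopologicalSpace X]

theorem exists_compactlySupported_eq_one [T2Space X] [LocallyCompactSpace X] {L U : Set X}
    (hL : IsCompact L) (hU : IsOpen U) (hLU : L ⊆ U) :
    ∃ χ : C_c(X, ℝ≥0), (∀ x ∈ L, χ x = 1) ∧ (∀ x ∉ U, χ x = 0) ∧ ∀ x, χ x ≤ 1 := by
  obtain ⟨r, hr1, hr0, hrc, hr⟩ := exists_continuous_one_zero_of_isCompact hL hU.isClosed_compl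
    (Set.disjoint_compl_right_iff_subset.2 hLU)
  refine ⟨(⟨r, hrc⟩ : C_c(X, ℝ)).nnrealPart, fun x hx => ?_, fun x hx => ?_, fun x => ?_⟩
  · simp [hr1 hx]
  · simp [hr0 hx]
  · simpa using (hr x).2

/-- A nonnegative function in `C_c`, regarded as a complex valued one. -/
noncomputable def toComplexCc (f : C_c(X, ℝ≥0)) : C_c(X, ℂ) where
  toFun x := ((f x : ℝ) : ℂ)
  continuous_toFun := by fun_prop
  hasCompactSupport' := f.hasCompactSupport.comp_left (g := fun r : ℝ≥0 => ((r : ℝ) : ℂ)) rfl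

@[simp]
theorem toComplexCc_apply (f : C_c(X, ℝ≥0)) (x : X) : toComplexCc f x = ((f x : ℝ) : ℂ) := rfl

theorem exists_compactlySupported_eqOn [T2Space X] [LocallyCompactSpace X] {f : X → ℂ}
    (hf : Continuous f) {L : Set X} (hL : IsCompact L) : ∃ F : C_c(X, ℂ), Set.EqOn F f L := by
  obtain ⟨χ, hχ, -⟩ := exists_compactlySupported_eq_one hL isOpen_univ (Set.subset_univ L)
  exact ⟨(⟨f, hf⟩ : C(X, ℂ)) • toComplexCc χ, fun x hx => by simp [hχ x hx]⟩

end Urysohn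

section WeaklyContinuous

variable {X Y : Type*} [TopologicalSpace X] [MeasurableSpace X]

theorem lintegral_le_measure_of_le_one {U : Set X} {μ : Measure X} {f : C_c(X, ℝ≥0)}
    (h1 : ∀ x, f x ≤ 1) (h0 : ∀ x ∉ U, f x = 0) : ∫⁻ x, f x ∂μ ≤ μ U :=
  lintegral_le_meas (fun x => by exact_mod_cast h1 x) fun x hx => by simp [h0 x hx]

variable [T2Space X] [LocallyCompactSpace X] [BorelSpace X] [TopologicalSpace Y]
  {κ : Y → Measure X} [∀ y, (κ y).Regular]

theorem exists_lt_lintegral_of_lt_measure {U : Set X} (hU : IsOpen U) {c : ℝ≥0∞} {μ : Measure X}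
    [μ.Regular] (h : c < μ U) :
    ∃ f : C_c(X, ℝ≥0), (∀ x, f x ≤ 1) ∧ (∀ x ∉ U, f x = 0) ∧ c < ∫⁻ x, f x ∂μ := by
  obtain ⟨L, hLU, hL, hcL⟩ := hU.exists_lt_isCompact h
  obtain ⟨χ, hχL, hχU, hχ⟩ := exists_compactlySupported_eq_one hL hU hLU
  refine ⟨χ, hχ, hχU, hcL.trans_le (meas_le_lintegral₀ (by fun_prop) fun x hx => ?_)⟩
  simp [hχL x hx]

theorem lowerSemicontinuous_measure_of_isOpen
    (hκ : ∀ f : C_c(X, ℝ≥0), Continuous fun y => ∫⁻ x, f x ∂(κ y)) {U : Set X} (hU : IsOpen U) :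
    LowerSemicontinuous fun y => κ y U := by
  intro y c hc
  obtain ⟨f, hf1, hf0, hcf⟩ := exists_lt_lintegral_of_lt_measure hU hc
  filter_upwards [(hκ f).continuousAt.eventually_const_lt hcf] with z hz
  exact hz.trans_le (lintegral_le_measure_of_le_one hf1 hf0)

theorem measurable_of_continuous_lintegral [MeasurableSpace Y] [OpensMeasurableSpace Y]
    [∀ y, IsProbabilityMeasure (κ y)]
    (hκ : ∀ f : C_c(X, ℝ≥0), Continuous fun y => ∫⁻ x, f x ∂(κ y)) : Measurable κ :=
  Measurable.measure_of_isPiSystem_of_isProbabilityMeasure BorelSpace.measurable_eq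
    isPiSystem_isOpen fun _ hU => (lowerSemicontinuous_measure_of_isOpen hκ hU).measurable

theorem exists_forall_lt_lintegral_of_lt_measure
    (hκ : ∀ f : C_c(X, ℝ≥0), Continuous fun y => ∫⁻ x, f x ∂(κ y)) {U : Set X} (hU : IsOpen U)
    {C : Set Y} (hC : IsCompact C) {c : ℝ≥0∞} (h : ∀ y ∈ C, c < κ y U) :
    ∃ f : C_c(X, ℝ≥0), (∀ x, f x ≤ 1) ∧ (∀ x ∉ U, f x = 0) ∧ ∀ y ∈ C, c < ∫⁻ x, f x ∂(κ y) := by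
  refine hC.induction_on (p := fun S => ∃ f : C_c(X, ℝ≥0), (∀ x, f x ≤ 1) ∧ (∀ x ∉ U, f x = 0) ∧
    ∀ y ∈ S, c < ∫⁻ x, f x ∂(κ y)) ⟨0, by simp⟩ ?_ ?_ fun y hy => ?_
  · rintro S T hST ⟨f, hf1, hf0, hf⟩
    exact ⟨f, hf1, hf0, fun y hy => hf y (hST hy)⟩
  · rintro S T ⟨f, hf1, hf0, hf⟩ ⟨g, hg1, hg0, hg⟩
    refine ⟨f ⊔ g, fun x => sup_le (hf1 x) (hg1 x), fun x hx => by simp [hf0 x hx, hg0 x hx], ?_⟩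
    rintro y (hy | hy)
    · exact (hf y hy).trans_le (lintegral_mono fun x => by simp)
    · exact (hg y hy).trans_le (lintegral_mono fun x => by simp)
  · obtain ⟨f, hf1, hf0, hcf⟩ := exists_lt_lintegral_of_lt_measure hU (h y hy)
    exact ⟨_, mem_nhdsWithin_of_mem_nhds ((hκ f).continuousAt.eventually_const_lt hcf),
      f, hf1, hf0, fun _ hz => hz⟩

variable [MeasurableSpace Y] [OpensMeasurableSpace Y] {μ : Measure Y} {ν : Measure X}

theorem mul_measure_le_of_forall_lt_measure [T2Space Y]
    (hκ : ∀ f : C_c(X, ℝ≥0), Continuous fun y => ∫⁻ x, f x ∂(κ y))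
    (hν : ∀ f : C_c(X, ℝ≥0), ∫⁻ y, ∫⁻ x, f x ∂(κ y) ∂μ ≤ ∫⁻ x, f x ∂ν)
    {U : Set X} (hU : IsOpen U) {C : Set Y} (hC : IsCompact C) {c : ℝ≥0∞}
    (h : ∀ y ∈ C, c < κ y U) : c * μ C ≤ ν U := by
  obtain ⟨f, hf1, hf0, hf⟩ := exists_forall_lt_lintegral_of_lt_measure hκ hU hC h
  calc c * μ C = ∫⁻ _ in C, c ∂μ := (setLIntegral_const C c).symm
    _ ≤ ∫⁻ y in C, ∫⁻ x, f x ∂(κ y) ∂μ :=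
      setLIntegral_mono' hC.measurableSet fun y hy => (hf y hy).le
    _ ≤ ∫⁻ y, ∫⁻ x, f x ∂(κ y) ∂μ := setLIntegral_le_lintegral _ _
    _ ≤ ν U := (hν f).trans (lintegral_le_measure_of_le_one hf1 hf0)

theorem ae_measure_eq_zero [T2Space Y] [μ.InnerRegular] [IsFiniteMeasureOnCompacts ν]
    [ν.InnerRegularCompactLTTop] [∀ y, IsProbabilityMeasure (κ y)]
    (hκ : ∀ f : C_c(X, ℝ≥0), Continuous fun y => ∫⁻ x, f x ∂(κ y))
    (hκC : ∀ C : Set Y, IsCompact C → ∃ L : Set X, IsCompact L ∧ ∀ y ∈ C, κ y Lᶜ = 0)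
    (hν : ∀ f : C_c(X, ℝ≥0), ∫⁻ y, ∫⁻ x, f x ∂(κ y) ∂μ ≤ ∫⁻ x, f x ∂ν)
    {N : Set X} (hN : ν N = 0) : ∀ᵐ y ∂μ, κ y N = 0 := by
  wlog hNm : MeasurableSet N generalizing N
  · exact (this (by rwa [measure_toMeasurable]) (measurableSet_toMeasurable ν N)).mono
      fun y hy => measure_mono_null (subset_toMeasurable ν N) hy
  have hmeas : Measurable fun y => κ y N :=
    (Measure.measurable_coe hNm).comp (measurable_of_continuous_lintegral hκ)
  suffices h : ∀ n : ℕ, ∀ᵐ y ∂μ, κ y N ≤ (n : ℝ≥0∞)⁻¹ by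
    filter_upwards [ae_all_iff.2 h] with y hy
    by_contra hne
    obtain ⟨n, hn⟩ := ENNReal.exists_inv_nat_lt hne
    exact (hy n).not_gt hn
  intro n
  by_contra hpos
  simp only [ae_iff, not_le] at hpos
  obtain ⟨C, hCN, hC, hμC⟩ :=
    (measurableSet_lt measurable_const hmeas).exists_lt_isCompact (pos_iff_ne_zero.2 hpos)
  obtain ⟨L, hL, hκL⟩ := hκC C hC
  obtain ⟨V, hLV, hV, hνV⟩ := hL.exists_open_superset_measure_lt_top ν
  have : Fact (ν V < ∞) := ⟨hνV⟩
  have hlt : ν.restrict V N < (n : ℝ≥0∞)⁻¹ * μ C := by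
    rw [Measure.restrict_apply hNm, measure_mono_null Set.inter_subset_left hN]
    exact ENNReal.mul_pos (ENNReal.inv_ne_zero.2 (ENNReal.natCast_ne_top n)) hμC.ne'
  obtain ⟨U, hNU, hU, hνU⟩ := Set.exists_isOpen_lt_of_lt N _ hlt
  rw [Measure.restrict_apply hU.measurableSet] at hνU
  refine hνU.not_ge (mul_measure_le_of_forall_lt_measure hκ hν (hU.inter hV) hC fun y hy => ?_)
  refine (hCN hy).trans_le (measure_mono_ae ?_)
  filter_upwards [measure_eq_zero_iff_ae_notMem.1 (hκL y hy)] with x hxL hxN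
  exact ⟨hNU hxN, hLV (not_not.1 hxL)⟩

end WeaklyContinuous

section L1

theorem exists_strongDual_eq_setIntegral {X : Type*} [MeasurableSpace X] {μ : Measure X}
    (s : Set X) :
    ∃ Φ : StrongDual ℂ (Lp ℂ 1 μ), ∀ f : Lp ℂ 1 μ, Φ f = ∫ x in s, f x ∂μ := by
  refine ⟨(L1.integralCLM' ℂ).comp (LpToLpRestrictCLM X ℂ ℂ μ 1 s), fun f => ?_⟩
  rw [← integral_congr_ae (LpToLpRestrictCLM_coeFn ℂ s f), ← L1.integral_eq_integral,
    L1.integral_eq' ℂ]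
  rfl

variable {X : Type*} [TopologicalSpace X] [MeasurableSpace X] [BorelSpace X] (μ : Measure X)
  [IsFiniteMeasureOnCompacts μ]

/-- The class in `L¹` of a continuous function with compact support. -/
noncomputable def toL1 : C_c(X, ℂ) →ₗ[ℂ] Lp ℂ 1 μ where
  toFun f := f.integrable.toL1 f
  map_add' f g := Integrable.toL1_add f g f.integrable g.integrable
  map_smul' c f := Integrable.toL1_smul' f f.integrable c

theorem coeFn_toL1 (f : C_c(X, ℂ)) : toL1 μ f =ᵐ[μ] f := f.integrable.coeFn_toL1

theorem norm_toL1 (f : C_c(X, ℂ)) : ‖toL1 μ f‖ = ∫ x, ‖f x‖ ∂μ := by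
  rw [L1.norm_eq_integral_norm]
  exact integral_congr_ae ((coeFn_toL1 μ f).fun_comp norm)

variable {μ} in
theorem exists_compactlySupported_eLpNorm_sub_indicator_le [T2Space X] [LocallyCompactSpace X]
    [μ.InnerRegularCompactLTTop] (c : ℂ) {s : Set X} (hs : MeasurableSet s) (hμs : μ s < ∞)
    {ε : ℝ≥0∞} (hε : ε ≠ 0) :
    ∃ f : C_c(X, ℂ), eLpNorm (⇑f - s.indicator fun _ => c) 1 μ ≤ ε := by
  obtain ⟨η, hη, hηε⟩ := exists_eLpNorm_indicator_le (μ := μ) ENNReal.one_ne_top c hε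
  have hη2 : (η : ℝ≥0∞) / 2 ≠ 0 := (ENNReal.half_pos (by simpa using hη.ne')).ne'
  obtain ⟨U, hU, hμU, hsU⟩ := hs.exists_isOpen_symmDiff_lt hμs.ne hη2
  obtain ⟨L, hLU, hL, hμL⟩ := hU.measurableSet.exists_isCompact_sdiff_lt hμU.ne hη2
  obtain ⟨χ, hχL, hχU, hχ⟩ := exists_compactlySupported_eq_one hL hU hLU
  refine ⟨c • toComplexCc χ, le_trans (eLpNorm_mono fun x => ?_)
    (hηε (symmDiff U s ∪ U \ L) ((measure_union_le _ _).trans ?_))⟩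
  · have hχx : |(χ x : ℝ) - s.indicator 1 x| ≤ (symmDiff U s ∪ U \ L).indicator 1 x := by
      have h1 : (χ x : ℝ) ≤ 1 := hχ x
      by_cases hxL : x ∈ L
      · by_cases hxs : x ∈ s <;> simp [hxL, hxs, hχL x hxL, hLU hxL, Set.mem_symmDiff]
      · by_cases hxU : x ∈ U <;> by_cases hxs : x ∈ s <;>
          simp [hxL, hxs, hxU, hχU x, h1, Set.mem_symmDiff, abs_of_nonpos]
    have hfx : (c • toComplexCc χ) x - s.indicator (fun _ => c) x =
        ((χ x : ℝ) - s.indicator 1 x : ℝ) * c := by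
      by_cases hxs : x ∈ s <;> simp [hxs] <;> ring
    calc ‖(⇑(c • toComplexCc χ) - s.indicator fun _ => c) x‖
        = |(χ x : ℝ) - s.indicator 1 x| * ‖c‖ := by
          rw [Pi.sub_apply, hfx, norm_mul, Complex.norm_real, Real.norm_eq_abs]
      _ ≤ (symmDiff U s ∪ U \ L).indicator 1 x * ‖c‖ := by gcongr
      _ = ‖(symmDiff U s ∪ U \ L).indicator (fun _ => c) x‖ := by
          rw [norm_indicator_eq_indicator_norm, ← Set.indicator_mul_const]; simp
  · rw [← ENNReal.add_halves (η : ℝ≥0∞)]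
    exact add_le_add hsU.le hμL.le

theorem denseRange_toL1 [T2Space X] [LocallyCompactSpace X] [μ.InnerRegularCompactLTTop] :
    DenseRange (toL1 μ) := by
  intro f
  refine EMetric.mem_closure_iff.2 fun ε hε => ?_
  obtain ⟨δ, hδ, hδε⟩ := exists_between hε
  obtain ⟨_, hfg, g, rfl⟩ := (Lp.memLp f).induction_dense ENNReal.one_ne_top
    (fun g => ∃ F : C_c(X, ℂ), ⇑F = g) (fun c s hs hμs ε hε => by
      obtain ⟨F, hF⟩ := exists_compactlySupported_eLpNorm_sub_indicator_le c hs hμs hε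
      exact ⟨F, hF, F, rfl⟩)
    (by rintro _ _ ⟨F, rfl⟩ ⟨G, rfl⟩; exact ⟨F + G, rfl⟩)
    (by rintro _ ⟨F, rfl⟩; exact F.integrable.aestronglyMeasurable) hδ.ne'
  refine ⟨toL1 μ g, ⟨g, rfl⟩, lt_of_eq_of_lt ?_ (hfg.trans_lt hδε)⟩
  rw [Lp.edist_def]
  exact eLpNorm_congr_ae ((Filter.EventuallyEq.refl _ _).sub (coeFn_toL1 μ g))

end L1

section ContinuousFamily

variable {X Y : Type*} [TopologicalSpace X] [TopologicalSpace Y]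

/-- A family `H` of functions in `C_c(X)` which is jointly continuous, and whose members with
parameter in a compact set have supports in a common compact set. It can be integrated against
functions in `C_c(Y)`, and these integrals commute with bounded functionals on `L¹`. -/
structure IsContinuousFamily (H : Y → C_c(X, ℂ)) : Prop where
  continuous : Continuous fun p : Y × X => H p.1 p.2
  exists_isCompact : ∀ B : Set Y, IsCompact B →
    ∃ C : Set X, IsCompact C ∧ ∀ t ∈ B, ∀ x ∉ C, H t x = 0

namespace IsContinuousFamily

variable {H : Y → C_c(X, ℂ)}

theorem comp {Z : Type*} [TopologicalSpace Z] (hH : IsContinuousFamily H) {φ : Z → Y}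
    (hφ : Continuous φ) : IsContinuousFamily fun z => H (φ z) where
  continuous := hH.continuous.comp (hφ.prodMap continuous_id)
  exists_isCompact B hB := by
    obtain ⟨C, hC, h⟩ := hH.exists_isCompact _ (hB.image hφ)
    exact ⟨C, hC, fun t ht => h _ (Set.mem_image_of_mem φ ht)⟩

theorem continuous_mul (hH : IsContinuousFamily H) (f : C_c(Y, ℂ)) :
    Continuous fun p : X × Y => f p.2 * H p.2 p.1 :=
  (f.continuous.comp continuous_snd).mul (hH.continuous.comp continuous_swap)

theorem hasCompactSupport_mul [T2Space X] (hH : IsContinuousFamily H) (f : C_c(Y, ℂ)) :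
    HasCompactSupport fun p : X × Y => f p.2 * H p.2 p.1 := by
  obtain ⟨C, hC, h⟩ := hH.exists_isCompact _ f.hasCompactSupport
  refine HasCompactSupport.intro' (hC.prod f.hasCompactSupport)
    (hC.isClosed.prod (isClosed_tsupport f)) fun p hp => ?_
  by_cases ht : p.2 ∈ tsupport f
  · rw [h _ ht _ fun hx => hp ⟨hx, ht⟩, mul_zero]
  · rw [image_eq_zero_of_notMem_tsupport ht, zero_mul]

theorem continuous_toL1 [MeasurableSpace X] [BorelSpace X] (μ : Measure X)
    [IsFiniteMeasureOnCompacts μ] [LocallyCompactSpace Y] (hH : IsContinuousFamily H) :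
    Continuous fun t => toL1 μ (H t) := by
  refine continuous_iff_continuousAt.2 fun t => ?_
  obtain ⟨B, hB, htB⟩ := exists_compact_mem_nhds t
  obtain ⟨C, hC, h⟩ := hH.exists_isCompact B hB
  have hcont : ContinuousOn (fun s => ∫ x, ‖H s x - H t x‖ ∂μ) B := by
    refine continuousOn_integral_of_compact_support hC ?_ fun s x hs hx => ?_
    · exact (hH.continuous.sub ((H t).continuous.comp continuous_snd)).norm.continuousOn
    · simp [h s hs x hx, h t (mem_of_mem_nhds htB) x hx]
  refine tendsto_iff_norm_sub_tendsto_zero.2 ?_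
  simpa [← map_sub, norm_toL1] using (hcont.continuousAt htB).tendsto

variable [T2Space X] [MeasurableSpace Y] [BorelSpace Y]

/-- The integral `x ↦ ∫ f(t) H_t(x) dν(t)` of a continuous family. -/
noncomputable def integral (hH : IsContinuousFamily H) (f : C_c(Y, ℂ)) (ν : Measure Y)
    [IsFiniteMeasureOnCompacts ν] : C_c(X, ℂ) where
  toFun x := ∫ t, f t * H t x ∂ν
  continuous_toFun := by
    refine continuousOn_univ.1 (continuousOn_integral_of_compact_support f.hasCompactSupport
      (hH.continuous_mul f).continuousOn fun x t _ ht => ?_)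
    rw [image_eq_zero_of_notMem_tsupport ht, zero_mul]
  hasCompactSupport' := by
    obtain ⟨C, hC, h⟩ := hH.exists_isCompact _ f.hasCompactSupport
    refine HasCompactSupport.intro hC fun x hx => integral_eq_zero_of_ae (.of_forall fun t => ?_)
    by_cases ht : t ∈ tsupport f
    · simp [h t ht x hx]
    · simp [image_eq_zero_of_notMem_tsupport ht]

theorem integral_apply (hH : IsContinuousFamily H) (f : C_c(Y, ℂ)) (ν : Measure Y)
    [IsFiniteMeasureOnCompacts ν] (x : X) : hH.integral f ν x = ∫ t, f t * H t x ∂ν := rfl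

variable [MeasurableSpace X] [BorelSpace X] (μ : Measure X) [IsFiniteMeasureOnCompacts μ]

theorem toL1_integral [LocallyCompactSpace Y] (hH : IsContinuousFamily H) (f : C_c(Y, ℂ))
    (ν : Measure Y) [IsFiniteMeasureOnCompacts ν] :
    toL1 μ (hH.integral f ν) = ∫ t, f t • toL1 μ (H t) ∂ν := by
  have hint : Integrable (fun t => f t • toL1 μ (H t)) ν :=
    (f.continuous.smul (hH.continuous_toL1 μ)).integrable_of_hasCompactSupport
      f.hasCompactSupport.smul_right
  refine Lp.ext (Integrable.ae_eq_of_forall_setIntegral_eq _ _ (L1.integrable_coeFn _)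
    (L1.integrable_coeFn _) fun s _ _ => ?_)
  obtain ⟨Φ, hΦ⟩ := exists_strongDual_eq_setIntegral (μ := μ) s
  have hΦ' (u : C_c(X, ℂ)) : Φ (toL1 μ u) = ∫ x in s, u x ∂μ :=
    (hΦ _).trans (integral_congr_ae (ae_restrict_of_ae (coeFn_toL1 μ u)))
  rw [← hΦ, ← hΦ, ← Φ.integral_comp_comm hint, hΦ']
  simp only [integral_apply, map_smul, hΦ', smul_eq_mul, ← integral_const_mul]
  exact integral_integral_swap_of_hasCompactSupport (hH.continuous_mul f)
    (hH.hasCompactSupport_mul f)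

theorem apply_toL1_integral [LocallyCompactSpace Y] (hH : IsContinuousFamily H)
    (D : StrongDual ℂ (Lp ℂ 1 μ)) (f : C_c(Y, ℂ)) (ν : Measure Y) [IsFiniteMeasureOnCompacts ν] :
    D (toL1 μ (hH.integral f ν)) = ∫ t, f t * D (toL1 μ (H t)) ∂ν := by
  rw [toL1_integral, ← D.integral_comp_comm]
  · simp only [map_smul, smul_eq_mul]
  · exact (f.continuous.smul (hH.continuous_toL1 μ)).integrable_of_hasCompactSupport
      f.hasCompactSupport.smul_right

end IsContinuousFamily

end ContinuousFamily

theorem lintegral_pos_of_mem_support {X : Type*} [TopologicalSpace X] [MeasurableSpace X]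
    [BorelSpace X] {μ : Measure X} {f : X → ℝ≥0∞} (hf : Continuous f) {a : X} (ha : a ∈ μ.support)
    (hfa : f a ≠ 0) : 0 < ∫⁻ x, f x ∂μ := by
  rw [lintegral_pos_iff_support hf.measurable]
  exact (Measure.mem_support_iff_forall a).1 ha _ (hf.continuousAt.eventually_ne hfa)

theorem lintegral_compactlySupported_ne_top {X : Type*} [TopologicalSpace X] [MeasurableSpace X]
    [BorelSpace X] (μ : Measure X) [IsFiniteMeasureOnCompacts μ] (f : C_c(X, ℝ≥0)) :
    ∫⁻ x, f x ∂μ ≠ ∞ := by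
  have h := ((toComplexCc f).integrable (μ := μ)).hasFiniteIntegral
  simpa [HasFiniteIntegral, enorm_eq_nnnorm, lt_top_iff_ne_top] using h

theorem integral_toComplexCc {X : Type*} [TopologicalSpace X] [MeasurableSpace X] [BorelSpace X]
    (μ : Measure X) (f : C_c(X, ℝ≥0)) :
    ∫ x, toComplexCc f x ∂μ = ((∫⁻ x, f x ∂μ).toReal : ℂ) := by
  simp only [toComplexCc_apply, integral_complex_ofReal]
  rw [integral_eq_lintegral_of_nonneg_ae (.of_forall fun x => (f x).coe_nonneg)
    (NNReal.continuous_coe.comp f.continuous).aestronglyMeasurable]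
  simp only [ENNReal.ofReal_coe_nnreal]

theorem lintegral_lintegral_eq_ofReal_re {X Y : Type*} [TopologicalSpace X] [MeasurableSpace X]
    [BorelSpace X] [MeasurableSpace Y] {μ : Measure Y} (κ : Y → Measure X)
    [∀ y, IsFiniteMeasureOnCompacts (κ y)] (f : C_c(X, ℝ≥0))
    (h : Integrable (fun y => ∫ x, toComplexCc f x ∂(κ y)) μ) :
    ∫⁻ y, ∫⁻ x, f x ∂(κ y) ∂μ = ENNReal.ofReal (∫ y, ∫ x, toComplexCc f x ∂(κ y) ∂μ).re := by
  have hre := h.re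
  simp only [integral_toComplexCc, RCLike.re_to_complex, Complex.ofReal_re] at hre
  simp only [integral_toComplexCc, integral_complex_ofReal, Complex.ofReal_re]
  rw [ofReal_integral_eq_lintegral_ofReal hre (.of_forall fun _ => ENNReal.toReal_nonneg)]
  simp only [ENNReal.ofReal_toReal (lintegral_compactlySupported_ne_top _ f)]

theorem lintegral_lintegral_eq_of_integral_eq {X Y : Type*} [TopologicalSpace X]
    [MeasurableSpace X] [BorelSpace X] [MeasurableSpace Y] {μ : Measure Y} {ν : Measure X}
    [IsFiniteMeasureOnCompacts ν] {κ : Y → Measure X} [∀ y, IsFiniteMeasureOnCompacts (κ y)]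
    {f : C_c(X, ℝ≥0)} (h : Integrable (fun y => ∫ x, toComplexCc f x ∂(κ y)) μ)
    (heq : ∫ y, ∫ x, toComplexCc f x ∂(κ y) ∂μ = ∫ x, toComplexCc f x ∂ν) :
    ∫⁻ y, ∫⁻ x, f x ∂(κ y) ∂μ = ∫⁻ x, f x ∂ν := by
  rw [lintegral_lintegral_eq_ofReal_re κ f h, heq, integral_toComplexCc, Complex.ofReal_re,
    ENNReal.ofReal_toReal (lintegral_compactlySupported_ne_top ν f)]

theorem support_dirac {X : Type*} [TopologicalSpace X] [T1Space X] [MeasurableSpace X]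
    [OpensMeasurableSpace X] (x : X) : (Measure.dirac x).support = {x} := by
  refine (Measure.support_subset_of_isClosed isClosed_singleton ?_).antisymm
    (Set.singleton_subset_iff.2 ?_)
  · exact (mem_ae_dirac_iff (measurableSet_singleton x)).2 rfl
  · exact (Measure.mem_support_iff_forall x).2 fun U hU => by
      simp [Measure.dirac_apply_of_mem (mem_of_mem_nhds hU)]

theorem isClosed_mem_support {X Y : Type*} [TopologicalSpace X] [R1Space X] [LocallyCompactSpace X]
    [MeasurableSpace X] [TopologicalSpace Y] {κ : Y → Measure X}
    (hκ : ∀ U : Set X, IsOpen U → IsOpen {y | (κ y).support ⊆ U}) :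
    IsClosed {q : X × Y | q.1 ∈ (κ q.2).support} := by
  rw [← isOpen_compl_iff, isOpen_iff_mem_nhds]
  rintro ⟨u, y⟩ hu
  have hu' : {u} ⊆ ((κ y).support)ᶜ := by simpa using hu
  obtain ⟨C, -, hCc, huC, hCs⟩ := exists_compact_closed_between isCompact_singleton
    Measure.isClosed_support.isOpen_compl hu'
  have hCu : interior C ∈ 𝓝 u := isOpen_interior.mem_nhds (huC rfl)
  have hCy : ∀ᶠ z in 𝓝 y, (κ z).support ⊆ Cᶜ :=
    (hκ _ hCc.isOpen_compl).mem_nhds (Set.subset_compl_comm.1 hCs)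
  filter_upwards [prod_mem_nhds hCu hCy] with q hq hq'
  exact hq.2 hq' (interior_subset hq.1)

theorem exists_isCompact_forall_subset_of_isOpen {X Y : Type*} [TopologicalSpace X]
    [LocallyCompactSpace X] [TopologicalSpace Y] {S : Y → Set X} (hS : ∀ y, IsCompact (S y))
    (hSo : ∀ U : Set X, IsOpen U → IsOpen {y | S y ⊆ U}) {P : Set Y} (hP : IsCompact P) :
    ∃ C : Set X, IsCompact C ∧ ∀ y ∈ P, S y ⊆ C := by
  refine hP.induction_on (p := fun P => ∃ C : Set X, IsCompact C ∧ ∀ y ∈ P, S y ⊆ C)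
    ⟨∅, isCompact_empty, by simp⟩ ?_ ?_ fun y _ => ?_
  · rintro P Q hPQ ⟨C, hC, h⟩
    exact ⟨C, hC, fun y hy => h y (hPQ hy)⟩
  · rintro P Q ⟨C, hC, h⟩ ⟨C', hC', h'⟩
    exact ⟨C ∪ C', hC.union hC', fun y hy => hy.elim
      (fun hy => (h y hy).trans Set.subset_union_left)
      fun hy => (h' y hy).trans Set.subset_union_right⟩
  · obtain ⟨C, hC, hyC⟩ := exists_compact_superset (hS y)
    exact ⟨_, mem_nhdsWithin_of_mem_nhds ((hSo _ isOpen_interior).mem_nhds hyC), C, hC,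
      fun z hz => Set.Subset.trans hz interior_subset⟩

namespace Hypergroup

attribute [instance] isProbabilityMeasure_ω regular_ω

section Translation

variable {K : Type*} [TopologicalSpace K] [T2Space K] [LocallyCompactSpace K]
  [MeasurableSpace K] [BorelSpace K] [Hypergroup K] {f g : K → ℂ}

theorem ae_mem_support (x y : K) : ∀ᵐ t ∂(ω x y), t ∈ (ω x y).support :=
  Measure.support_mem_ae_of_regular

theorem integrable_ω (hf : Continuous f) (x y : K) : Integrable f (ω x y) := by
  rw [← Measure.restrict_eq_self_of_ae_mem (ae_mem_support x y)]
  exact hf.continuousOn.integrableOn_compact (isCompact_support_ω x y)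

theorem translate_congr {x y : K} (h : Set.EqOn f g (ω x y).support) :
    translate x f y = translate x g y :=
  integral_congr_ae ((ae_mem_support x y).mono h)

theorem norm_translate_le {x y : K} {c : ℝ} (h : ∀ t ∈ (ω x y).support, ‖f t‖ ≤ c) :
    ‖translate x f y‖ ≤ c := by
  simpa [translate] using norm_integral_le_of_norm_le_const ((ae_mem_support x y).mono h)

theorem exists_mem_support_ne_zero {x y : K} (h : translate x f y ≠ 0) :
    ∃ t ∈ (ω x y).support, f t ≠ 0 := by
  by_contra! hzero
  exact h (norm_le_zero_iff.1 (norm_translate_le fun t ht => by simp [hzero t ht]))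

theorem translate_sub (hf : Continuous f) (hg : Continuous g) (x : K) :
    translate x (f - g) = translate x f - translate x g :=
  funext fun y => integral_sub (integrable_ω hf x y) (integrable_ω hg x y)

theorem exists_isCompact_support_subset {P : Set (K × K)} (hP : IsCompact P) :
    ∃ C : Set K, IsCompact C ∧ ∀ p ∈ P, (ω p.1 p.2).support ⊆ C :=
  exists_isCompact_forall_subset_of_isOpen (S := fun p : K × K => (ω p.1 p.2).support)
    (fun p => isCompact_support_ω p.1 p.2) isOpen_support_subset hP

theorem translate_e (f : K → ℂ) : translate e f = f := by
  ext y
  rw [translate, e_ω, integral_dirac]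

theorem continuous_translate (hf : Continuous f) :
    Continuous fun p : K × K => translate p.1 f p.2 := by
  refine continuous_iff_continuousAt.2 fun p => ?_
  obtain ⟨C, hC, hpC⟩ := exists_compact_superset (isCompact_support_ω p.1 p.2)
  obtain ⟨F, hF⟩ := exists_compactlySupported_eqOn hf hC
  refine (continuous_ω F.toBoundedContinuousFunction).continuousAt.congr ?_
  filter_upwards [(isOpen_support_subset _ isOpen_interior).mem_nhds hpC] with q hq
  exact translate_congr (hF.mono (Set.Subset.trans hq interior_subset))

theorem translate_translate (hf : Continuous f) (x y z : K) :
    translate x (translate y f) z = ∫ t, translate t f z ∂(ω y x) := by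
  obtain ⟨C, hC, hCs⟩ := exists_isCompact_support_subset
    ((isCompact_singleton (x := y)).prod (isCompact_support_ω x z) |>.union
      ((isCompact_support_ω y x).prod (isCompact_singleton (x := z))))
  obtain ⟨F, hF⟩ := exists_compactlySupported_eqOn hf hC
  calc translate x (translate y f) z = translate x (translate y F) z :=
        translate_congr fun t ht => translate_congr (hF.symm.mono (hCs (y, t) (.inl ⟨rfl, ht⟩)))
    _ = ∫ t, translate t F z ∂(ω y x) := assoc_ω y x z F.toBoundedContinuousFunction
    _ = ∫ t, translate t f z ∂(ω y x) := integral_congr_ae <| (ae_mem_support y x).mono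
        fun t ht => translate_congr (hF.mono (hCs (t, z) (.inr ⟨ht, rfl⟩)))

theorem translate_translate_comm (hK : IsCommutative K) (hf : Continuous f) (x y : K) :
    translate x (translate y f) = translate y (translate x f) := by
  ext z
  rw [translate_translate hf, translate_translate hf, hK]

variable (K) in
/-- The involution as a homeomorphism. -/
def tildeHomeomorph : K ≃ₜ K where
  toFun := tilde
  invFun := tilde
  left_inv := tilde_tilde
  right_inv := tilde_tilde
  continuous_toFun := continuous_tilde
  continuous_invFun := continuous_tilde

theorem translate_comp_tilde (hK : IsCommutative K) (f : K → ℂ) (x y : K) :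
    translate x (f ∘ tilde) y = translate (tilde x) f (tilde y) := by
  rw [translate, translate, hK (tilde x), ← map_tilde_ω]
  exact (integral_map_equiv (tildeHomeomorph K).toMeasurableEquiv f).symm

end Translation

section Support

variable {K : Type*} [TopologicalSpace K] [T2Space K] [LocallyCompactSpace K]
  [MeasurableSpace K] [BorelSpace K] [Hypergroup K]

theorem continuous_lintegral_ω (f : C_c(K, ℝ≥0)) :
    Continuous fun p : K × K => ∫⁻ t, f t ∂(ω p.1 p.2) := by
  have hre := Complex.continuous_re.comp (continuous_translate (toComplexCc f).continuous)
  refine (ENNReal.continuous_ofReal.comp hre).congr fun p => ?_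
  change ENNReal.ofReal (∫ t, toComplexCc f t ∂(ω p.1 p.2)).re = _
  rw [integral_toComplexCc, Complex.ofReal_re,
    ENNReal.ofReal_toReal (lintegral_compactlySupported_ne_top _ f)]

theorem lintegral_ω_assoc (f : C_c(K, ℝ≥0)) (x y z : K) :
    ∫⁻ t, ∫⁻ s, f s ∂(ω x t) ∂(ω y z) = ∫⁻ t, ∫⁻ s, f s ∂(ω t z) ∂(ω x y) := by
  have hcont := continuous_translate (toComplexCc f).continuous
  rw [lintegral_lintegral_eq_ofReal_re (ω x) f
      (integrable_ω (hcont.comp (Continuous.prodMk_right x)) y z),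
    lintegral_lintegral_eq_ofReal_re (fun t => ω t z) f
      (integrable_ω (hcont.comp (Continuous.prodMk_left z)) x y)]
  congr 2
  exact assoc_ω x y z (toComplexCc f).toBoundedContinuousFunction

theorem exists_mem_support_assoc {x y z s t : K} (ht : t ∈ (ω y z).support)
    (hs : s ∈ (ω x t).support) : ∃ t' ∈ (ω x y).support, s ∈ (ω t' z).support := by
  by_contra! hdis
  have hclosed := isClosed_mem_support (κ := fun p : K × K => ω p.1 p.2) isOpen_support_subset
  have hcont : Continuous fun p : K × K => (p.1, p.2, z) := by fun_prop
  have hev : ∀ᶠ s' in 𝓝 s, ∀ t' ∈ (ω x y).support, s' ∉ (ω t' z).support :=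
    (isCompact_support_ω x y).eventually_forall_of_forall_eventually fun t' ht' =>
      (hclosed.isOpen_compl.preimage hcont).mem_nhds (x := (s, t')) (hdis t' ht')
  obtain ⟨U, hU, hUo, hsU⟩ := eventually_nhds_iff.1 hev
  obtain ⟨f, hf1, hf0, -⟩ := exists_compactlySupported_eq_one (isCompact_singleton (x := s)) hUo
    (Set.singleton_subset_iff.2 hsU)
  have hpos : 0 < ∫⁻ t, ∫⁻ s, f s ∂(ω x t) ∂(ω y z) :=
    lintegral_pos_of_mem_support ((continuous_lintegral_ω f).comp (Continuous.prodMk_right x)) ht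
      (lintegral_pos_of_mem_support (by fun_prop) hs (by simp [hf1 s rfl])).ne'
  refine hpos.ne' ?_
  rw [lintegral_ω_assoc]
  refine lintegral_eq_zero_of_ae_eq_zero ?_
  filter_upwards [ae_mem_support x y] with t' ht'
  refine lintegral_eq_zero_of_ae_eq_zero ?_
  filter_upwards [ae_mem_support t' z] with s' hs'
  simp [hf0 s' fun h => hU s' h t' ht' hs']

theorem tilde_mem_support {u t w : K} (hu : u ∈ (ω t w).support) :
    tilde w ∈ (ω (tilde u) t).support := by
  obtain ⟨r, hr, her⟩ := exists_mem_support_assoc hu ((e_mem_support_iff (tilde u) u).2 rfl)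
  rwa [← (e_mem_support_iff r w).1 her]

theorem tilde_e : tilde (e : K) = e :=
  ((e_mem_support_iff e e).1 (by simp [e_ω, support_dirac])).symm

theorem eventually_dist_lt_of_mem_support {f : K → ℂ} (hf : Continuous f) {C : Set K}
    (hC : IsCompact C) {ε : ℝ} (hε : 0 < ε) :
    ∀ᶠ u in 𝓝 (e : K), ∀ t ∈ C, ∀ s ∈ (ω (tilde u) t).support, dist (f s) (f t) < ε := by
  refine hC.eventually_forall_of_forall_eventually fun t _ => ?_
  obtain ⟨V, hVf, hVo, htV⟩ := eventually_nhds_iff.1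
    (hf.continuousAt.eventually (Metric.ball_mem_nhds (f t) (half_pos hε)))
  have hV : ∀ᶠ q in 𝓝 (e, t), (ω (tilde q.1) q.2).support ⊆ V := by
    have hcont : Continuous fun q : K × K => (tilde q.1, q.2) :=
      (continuous_tilde.comp continuous_fst).prodMk continuous_snd
    refine ((isOpen_support_subset V hVo).preimage hcont).mem_nhds ?_
    simpa [tilde_e, e_ω, support_dirac] using htV
  filter_upwards [hV, continuous_snd.continuousAt.eventually (hVo.mem_nhds htV)] with q hq hqt s hs
  have hs' := hVf s (hq hs)
  have ht' := hVf q.2 hqt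
  linarith [dist_triangle_right (f s) (f q.2) (f t), Metric.mem_ball.1 hs', Metric.mem_ball.1 ht']

theorem exists_isCompact_translate_eq_zero {A : Set K} (hA : IsCompact A) {f : K → ℂ}
    (hf : HasCompactSupport f) :
    ∃ C : Set K, IsCompact C ∧ ∀ x ∈ A, ∀ y ∉ C, translate x f y = 0 := by
  obtain ⟨C, hC, h⟩ :=
    exists_isCompact_support_subset ((hf.isCompact.image continuous_tilde).prod hA)
  refine ⟨tilde '' C, hC.image continuous_tilde, fun x hx y hy => by_contra fun hne => hy ?_⟩
  obtain ⟨t, ht, htf⟩ := exists_mem_support_ne_zero hne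
  exact ⟨tilde y, h (tilde t, x) ⟨Set.mem_image_of_mem _ (subset_tsupport f htf), hx⟩
    (tilde_mem_support ht), tilde_tilde y⟩

/-- The translate `T_x f` of a function in `C_c(K)`, as an element of `C_c(K)`. -/
noncomputable def translateCc (x : K) (f : C_c(K, ℂ)) : C_c(K, ℂ) where
  toFun := translate x f
  continuous_toFun := (continuous_translate f.continuous).comp (Continuous.prodMk_right x)
  hasCompactSupport' := by
    obtain ⟨C, hC, h⟩ :=
      exists_isCompact_translate_eq_zero (isCompact_singleton (x := x)) f.hasCompactSupport
    exact .intro hC (h x rfl)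

@[simp]
theorem coe_translateCc (x : K) (f : C_c(K, ℂ)) : ⇑(translateCc x f) = translate x f := rfl

theorem isContinuousFamily_translateCc (f : C_c(K, ℂ)) :
    IsContinuousFamily fun x => translateCc x f where
  continuous := continuous_translate f.continuous
  exists_isCompact _ hA := exists_isCompact_translate_eq_zero hA f.hasCompactSupport

end Support

end Hypergroup

section Bump

variable {X : Type*} [TopologicalSpace X] [MeasurableSpace X]

/-- Normalised bump functions supported in `U`, the members of an approximate identity. -/
structure IsBump (μ : Measure X) (U : Set X) (h : C_c(X, ℂ)) : Prop where
  eq_zero_of_notMem : ∀ x ∉ U, h x = 0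
  integral_eq_one : ∫ x, h x ∂μ = 1
  integral_norm_eq_one : ∫ x, ‖h x‖ ∂μ = 1

theorem exists_isBump [T2Space X] [LocallyCompactSpace X] [BorelSpace X] (μ : Measure X)
    [IsFiniteMeasureOnCompacts μ] [μ.IsOpenPosMeasure] {a : X} {U : Set X} (hU : U ∈ 𝓝 a) :
    ∃ h, IsBump μ U h := by
  obtain ⟨V, hVU, hVo, haV⟩ := mem_nhds_iff.1 hU
  obtain ⟨χ, hχ1, hχ0, -⟩ := exists_compactlySupported_eq_one (isCompact_singleton (x := a)) hVo
    (Set.singleton_subset_iff.2 haV)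
  have hne : (∫⁻ x, χ x ∂μ).toReal ≠ 0 := by
    refine (ENNReal.toReal_pos (ne_of_gt ?_) (lintegral_compactlySupported_ne_top μ χ)).ne'
    exact lintegral_pos_of_mem_support (f := fun x => (χ x : ℝ≥0∞)) (a := a) (by fun_prop)
      (by simp [Measure.support_eq_univ]) (by simp [hχ1 a rfl])
  have hint := integral_toComplexCc μ χ
  have hnorm : ∫ x, ‖toComplexCc χ x‖ ∂μ = (∫⁻ x, χ x ∂μ).toReal := by
    simp only [toComplexCc_apply, integral_complex_ofReal] at hint ⊢
    simpa using Complex.ofReal_injective hint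
  refine ⟨((∫⁻ x, χ x ∂μ).toReal : ℂ)⁻¹ • toComplexCc χ, fun x hx => ?_, ?_, ?_⟩
  · simp [hχ0 x fun h => hx (hVU h)]
  · simp only [CompactlySupportedContinuousMap.smul_apply, smul_eq_mul, integral_const_mul, hint]
    exact inv_mul_cancel₀ (Complex.ofReal_ne_zero.2 hne)
  · simp only [CompactlySupportedContinuousMap.smul_apply, norm_smul, integral_const_mul, hnorm]
    simp [hne]

/-- The filter along which bump functions concentrate at `a`. -/
def bumpFilter (μ : Measure X) (a : X) : Filter C_c(X, ℂ) :=
  (𝓝 a).lift' fun U => {h | IsBump μ U h}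

theorem mem_bumpFilter {μ : Measure X} {a : X} {s : Set C_c(X, ℂ)} :
    s ∈ bumpFilter μ a ↔ ∃ U ∈ 𝓝 a, ∀ h, IsBump μ U h → h ∈ s :=
  mem_lift'_sets (h := fun U => {h | IsBump μ U h}) fun _ _ hUV _ hh =>
    IsBump.mk (fun x hx => hh.1 x fun hxU => hx (hUV hxU)) hh.2 hh.3

instance neBot_bumpFilter [T2Space X] [LocallyCompactSpace X] [BorelSpace X] (μ : Measure X)
    [IsFiniteMeasureOnCompacts μ] [μ.IsOpenPosMeasure] (a : X) : (bumpFilter μ a).NeBot := by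
  refine neBot_iff.2 fun hbot => ?_
  obtain ⟨U, hU, h⟩ := mem_bumpFilter.1 (hbot ▸ mem_bot : ∅ ∈ bumpFilter μ a)
  obtain ⟨k, hk⟩ := exists_isBump μ hU
  exact h k hk

end Bump

namespace Hypergroup

section Invariance

variable {K : Type*} [TopologicalSpace K] [T2Space K] [LocallyCompactSpace K]
  [MeasurableSpace K] [BorelSpace K] [Hypergroup K] {m : Measure K}

namespace IsHaarMeasure

theorem lintegral_lintegral_ω (hm : IsHaarMeasure m) (f : C_c(K, ℝ≥0)) (x : K) :
    ∫⁻ y, ∫⁻ t, f t ∂(ω x y) ∂m = ∫⁻ t, f t ∂m := by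
  have := hm.isFiniteMeasureOnCompacts
  exact lintegral_lintegral_eq_of_integral_eq (translateCc x (toComplexCc f)).integrable
    (hm.integral_translate x _ (toComplexCc f).continuous (toComplexCc f).hasCompactSupport)

theorem isOpenPosMeasure (hm : IsHaarMeasure m) : m.IsOpenPosMeasure where
  open_pos U hUo := by
    rintro ⟨b, hb⟩ hU0
    have := hm.innerRegular
    obtain ⟨a, ha⟩ : m.support.Nonempty := by
      rw [Set.nonempty_iff_ne_empty]
      intro hempty
      have hmem := Measure.support_mem_ae_of_innerRegular (μ := m)
      rw [hempty, empty_mem_iff_bot, ae_eq_bot] at hmem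
      exact hm.ne_zero hmem
    obtain ⟨x, hx⟩ := (ae_mem_support a (tilde b)).exists
    have hxb : b ∈ (ω (tilde x) a).support := by simpa [tilde_tilde] using tilde_mem_support hx
    obtain ⟨f, hf1, hf0, hf⟩ := exists_compactlySupported_eq_one (isCompact_singleton (x := b)) hUo
      (Set.singleton_subset_iff.2 hb)
    have hpos : 0 < ∫⁻ y, ∫⁻ t, f t ∂(ω (tilde x) y) ∂m :=
      lintegral_pos_of_mem_support
        ((continuous_lintegral_ω f).comp (Continuous.prodMk_right (tilde x))) ha
        (lintegral_pos_of_mem_support (by fun_prop) hxb (by simp [hf1 b rfl])).ne'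
    rw [hm.lintegral_lintegral_ω] at hpos
    exact (hpos.trans_le (lintegral_le_measure_of_le_one hf hf0)).ne' hU0

theorem integral_norm_translate_le (hm : IsHaarMeasure m) (x : K) (f : C_c(K, ℂ)) :
    ∫ y, ‖translate x f y‖ ∂m ≤ ∫ y, ‖f y‖ ∂m := by
  have := hm.isFiniteMeasureOnCompacts
  let N : C_c(K, ℂ) := ⟨⟨fun y => (‖f y‖ : ℂ), by fun_prop⟩,
    f.hasCompactSupport.comp_left (g := fun z : ℂ => (‖z‖ : ℂ)) (by simp)⟩
  have hN (y : K) : translate x N y = ((∫ t, ‖f t‖ ∂(ω x y) : ℝ) : ℂ) := integral_complex_ofReal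
  calc ∫ y, ‖translate x f y‖ ∂m ≤ ∫ y, (translate x N y).re ∂m :=
        integral_mono (translateCc x f).integrable.norm (translateCc x N).integrable.re fun y =>
          (norm_integral_le_integral_norm _).trans_eq (congrArg Complex.re (hN y)).symm
    _ = (∫ y, translate x N y ∂m).re := integral_re (translateCc x N).integrable
    _ = ∫ y, ‖f y‖ ∂m := by
        rw [hm.integral_translate x N N.continuous N.hasCompactSupport]
        exact congrArg Complex.re integral_complex_ofReal

end IsHaarMeasure

end Invariance

section Average

variable {K : Type*} [TopologicalSpace K] [T2Space K] [LocallyCompactSpace K]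
  [MeasurableSpace K] [BorelSpace K] [Hypergroup K]

/-- The reflection `x ↦ f (x̃)` of a function in `C_c(K)`. -/
noncomputable def reflect (f : C_c(K, ℂ)) : C_c(K, ℂ) where
  toFun := f ∘ tilde
  continuous_toFun := f.continuous.comp continuous_tilde
  hasCompactSupport' := f.hasCompactSupport.comp_homeomorph (tildeHomeomorph K)

@[simp]
theorem reflect_apply (f : C_c(K, ℂ)) (x : K) : reflect f x = f (tilde x) := rfl

theorem reflect_reflect (f : C_c(K, ℂ)) : reflect (reflect f) = f := by
  ext x
  simp [tilde_tilde]

theorem translate_comm (hK : IsCommutative K) (f : K → ℂ) (x y : K) :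
    translate x f y = translate y f x := by
  rw [translate, hK, translate]

variable (m : Measure K) [IsFiniteMeasureOnCompacts m]

/-- The average `∫ f(z) T_z h dm(z)` of the translates of `h`. -/
noncomputable def average (f h : C_c(K, ℂ)) : C_c(K, ℂ) :=
  (isContinuousFamily_translateCc h).integral f m

theorem average_apply (f h : C_c(K, ℂ)) (x : K) :
    average m f h x = ∫ z, f z * translate z h x ∂m := rfl

theorem translateCc_average (hK : IsCommutative K) (f h : C_c(K, ℂ)) (x : K) :
    translateCc x (average m f h) = average m f (translateCc x h) := by
  ext y
  calc ∫ t, ∫ z, f z * translate z h t ∂m ∂(ω x y)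
      = ∫ z, ∫ t, f z * translate z h t ∂(ω x y) ∂m :=
        integral_integral_swap_of_hasCompactSupport (f := fun t z => f z * translate z h t)
          ((isContinuousFamily_translateCc h).continuous_mul f)
          ((isContinuousFamily_translateCc h).hasCompactSupport_mul f)
    _ = ∫ z, f z * translate x (translate z h) y ∂m :=
        integral_congr_ae (.of_forall fun z => integral_const_mul _ _)
    _ = ∫ z, f z * translate z (translate x h) y ∂m := by
        simp only [translate_translate_comm (f := h) hK h.continuous x]

theorem integral_mul_average (hK : IsCommutative K) (f g h : C_c(K, ℂ)) :
    ∫ x, g x * average m f h x ∂m = ∫ x, f x * average m g h x ∂m := by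
  have hH := isContinuousFamily_translateCc h
  calc ∫ x, g x * average m f h x ∂m
      = ∫ x, ∫ z, g x * (f z * translate z h x) ∂m ∂m := by
        simp only [average_apply, integral_const_mul]
    _ = ∫ z, ∫ x, g x * (f z * translate z h x) ∂m ∂m :=
        integral_integral_swap_of_hasCompactSupport (f := fun x z => g x * (f z * translate z h x))
          ((g.continuous.comp continuous_fst).mul (hH.continuous_mul f))
          (hH.hasCompactSupport_mul f).mul_left
    _ = ∫ z, f z * average m g h z ∂m := by
        refine integral_congr_ae (.of_forall fun z => ?_)
        simp only [average_apply, mul_left_comm, integral_const_mul, translate_comm hK h z]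

theorem tendsto_average (hK : IsCommutative K) (hm : IsHaarMeasure m) (f : C_c(K, ℂ)) :
    Tendsto (fun h => (average m f h).toContinuousMap) (bumpFilter m e)
      (𝓝 (reflect f).toContinuousMap) := by
  refine ContinuousMap.tendsto_iff_forall_isCompact_tendstoUniformlyOn.2 fun C hC =>
    Metric.tendstoUniformlyOn_iff.2 fun ε hε => ?_
  refine mem_bumpFilter.2 ⟨_, eventually_dist_lt_of_mem_support (reflect f).continuous hC
    (half_pos hε), fun h hh t ht => ?_⟩
  have hint : Integrable (translate t h) m := (translateCc t h).integrable
  have hmul : Integrable (fun z => f z * translate t h z) m := (f * translateCc t h).integrable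
  have hpointwise (z : K) :
      ‖(f z - reflect f t) * translate t h z‖ ≤ ε / 2 * ‖translate t h z‖ := by
    by_cases hne : translate t h z = 0
    · simp [hne]
    obtain ⟨u, hu, hhu⟩ := exists_mem_support_ne_zero hne
    have hclose := (by_contra fun hu' => hhu (hh.eq_zero_of_notMem u hu')) t ht (tilde z)
      (tilde_mem_support hu)
    rw [norm_mul]
    gcongr
    simpa [dist_eq_norm, tilde_tilde] using hclose.le
  have heq : average m f h t - reflect f t = ∫ z, (f z - reflect f t) * translate t h z ∂m := by
    simp only [sub_mul]
    rw [integral_sub hmul (hint.const_mul _), integral_const_mul,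
      hm.integral_translate t h h.continuous h.hasCompactSupport, hh.integral_eq_one, mul_one,
      average_apply]
    simp only [translate_comm hK h t]
  calc dist (reflect f t) (average m f h t)
      = ‖∫ z, (f z - reflect f t) * translate t h z ∂m‖ := by rw [dist_comm, dist_eq_norm, heq]
    _ ≤ ∫ z, ε / 2 * ‖translate t h z‖ ∂m :=
        norm_integral_le_of_norm_le (hint.norm.const_mul _) (.of_forall hpointwise)
    _ ≤ ε / 2 := by
        have hle := hm.integral_norm_translate_le t h
        rw [hh.integral_norm_eq_one] at hle
        rw [integral_const_mul]
        nlinarith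
    _ < ε := half_lt_self hε

variable {m}

theorem tendsto_integral_mul_translate {ι : Type*} {l : Filter ι} {F : ι → C(K, ℂ)} {G : C(K, ℂ)}
    (hF : Tendsto F l (𝓝 G)) (g : C_c(K, ℂ)) (x : K) :
    Tendsto (fun i => ∫ y, g y * translate x (F i) y ∂m) l
      (𝓝 (∫ y, g y * translate x G y ∂m)) := by
  obtain ⟨C, hC, hCs⟩ :=
    exists_isCompact_support_subset ((isCompact_singleton (x := x)).prod g.hasCompactSupport)
  have hint (F : C(K, ℂ)) : Integrable (fun y => g y * translate x F y) m :=
    (g.continuous.mul ((continuous_translate F.continuous).comp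
      (Continuous.prodMk_right x))).integrable_of_hasCompactSupport g.hasCompactSupport.mul_right
  refine Metric.tendsto_nhds.2 fun ε hε => ?_
  have hpos : 0 < ∫ y, ‖g y‖ ∂m + 1 := by positivity
  filter_upwards [Metric.tendstoUniformlyOn_iff.1
    (ContinuousMap.tendsto_iff_forall_isCompact_tendstoUniformlyOn.1 hF C hC) _
    (div_pos hε hpos)] with i hi
  have hpointwise (y : K) : ‖g y * translate x (F i) y - g y * translate x G y‖
      ≤ ‖g y‖ * (ε / (∫ y, ‖g y‖ ∂m + 1)) := by
    by_cases hy : y ∈ tsupport g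
    · rw [← mul_sub, ← Pi.sub_apply, ← translate_sub (F i).continuous G.continuous, norm_mul]
      refine mul_le_mul_of_nonneg_left (norm_translate_le fun t ht => ?_) (norm_nonneg _)
      simpa [dist_eq_norm'] using (hi t (hCs (x, y) ⟨rfl, hy⟩ ht)).le
    · simp [image_eq_zero_of_notMem_tsupport hy]
  rw [dist_eq_norm, ← integral_sub (hint _) (hint _)]
  refine (norm_integral_le_of_norm_le (g.integrable.norm.mul_const _)
    (.of_forall hpointwise)).trans_lt ?_
  rw [integral_mul_const, mul_div_left_comm]
  exact mul_lt_of_lt_one_right hε ((div_lt_one hpos).2 (lt_add_one _))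

end Average

section Adjoint

variable {K : Type*} [TopologicalSpace K] [T2Space K] [LocallyCompactSpace K]
  [MeasurableSpace K] [BorelSpace K] [Hypergroup K] {m : Measure K}

theorem integral_mul_translate_reflect (hK : IsCommutative K) (hm : IsHaarMeasure m)
    (f g : C_c(K, ℂ)) (x : K) :
    ∫ y, g y * translate x (reflect f) y ∂m = ∫ y, f y * translate x (reflect g) y ∂m := by
  have := hm.isFiniteMeasureOnCompacts
  have := hm.isOpenPosMeasure
  refine tendsto_nhds_unique_of_eventuallyEq
    (tendsto_integral_mul_translate (tendsto_average m hK hm f) g x)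
    (tendsto_integral_mul_translate (tendsto_average m hK hm g) f x) (.of_forall fun h => ?_)
  have htr (f : C_c(K, ℂ)) : translate x (average m f h) = average m f (translateCc x h) :=
    congrArg DFunLike.coe (translateCc_average m hK f h x)
  simp only [CompactlySupportedContinuousMap.coe_toContinuousMap, htr]
  exact integral_mul_average m hK f g _

theorem integral_reflect (hK : IsCommutative K) (hm : IsHaarMeasure m) (f : C_c(K, ℂ)) :
    ∫ y, reflect f y ∂m = ∫ y, f y ∂m := by
  obtain ⟨χ, hχ, -⟩ := exists_compactlySupported_eq_one
    (reflect f).hasCompactSupport.isCompact isOpen_univ (Set.subset_univ _)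
  have hmul (y : K) : toComplexCc χ y * reflect f y = reflect f y := by
    by_cases hy : reflect f y = 0
    · simp [hy]
    · simp [hχ y (subset_tsupport _ hy)]
  have h := integral_mul_translate_reflect hK hm f (toComplexCc χ) e
  simp only [translate_e, hmul] at h
  rw [h]
  refine integral_congr_ae (.of_forall fun y => ?_)
  simpa [tilde_tilde, mul_comm] using hmul (tilde y)

theorem integral_translate_mul (hK : IsCommutative K) (hm : IsHaarMeasure m)
    (f : C_c(K, ℂ)) {g : K → ℂ} (hg : Continuous g) (x : K) :
    ∫ y, translate x f y * g y ∂m = ∫ y, f y * translate (tilde x) g y ∂m := by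
  obtain ⟨C, hC, hCs⟩ := exists_isCompact_support_subset
    ((isCompact_singleton (x := tilde x)).prod f.hasCompactSupport)
  obtain ⟨G, hG⟩ := exists_compactlySupported_eqOn hg
    ((translateCc x f).hasCompactSupport.isCompact.union hC)
  calc ∫ y, translate x f y * g y ∂m = ∫ y, G y * translate x (reflect (reflect f)) y ∂m := by
        refine integral_congr_ae (.of_forall fun y => ?_)
        simp only [reflect_reflect]
        by_cases hy : translate x f y = 0
        · simp [hy]
        · rw [hG (.inl (subset_tsupport _ hy)), mul_comm]
    _ = ∫ y, reflect f y * translate x (reflect G) y ∂m :=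
        integral_mul_translate_reflect hK hm (reflect f) G x
    _ = ∫ y, reflect (f * translateCc (tilde x) G) y ∂m :=
        integral_congr_ae (.of_forall fun y =>
          congrArg (f (tilde y) * ·) (translate_comp_tilde hK G x y))
    _ = ∫ y, f y * translate (tilde x) G y ∂m := integral_reflect hK hm _
    _ = ∫ y, f y * translate (tilde x) g y ∂m := by
        refine integral_congr_ae (.of_forall fun y => ?_)
        by_cases hy : f y = 0
        · simp [hy]
        · exact congrArg (f y * ·) (translate_congr (hG.mono
            (.trans (hCs (tilde x, y) ⟨rfl, subset_tsupport _ hy⟩) Set.subset_union_right)))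

end Adjoint

theorem fourier_congr {K : Type*} [TopologicalSpace K] [MeasurableSpace K] {m : Measure K}
    {α : K →ᵇ ℂ} {f g : K → ℂ} (h : f =ᵐ[m] g) : fourier m f α = fourier m g α :=
  integral_congr_ae (h.mono fun x hx => congrArg (conj (α x) * ·) hx)

variable {K : Type*} [TopologicalSpace K] [T2Space K] [LocallyCompactSpace K]
  [MeasurableSpace K] [BorelSpace K] [Hypergroup K] {m : Measure K}

section Convolution

variable {f f' g g' : K → ℂ}

theorem ae_ω_eq_zero_of_continuous [m.InnerRegular] [IsFiniteMeasureOnCompacts m] {φ : K → K}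
    (hφ : Continuous φ) {x : K}
    (h : ∀ f : C_c(K, ℝ≥0), ∫⁻ y, ∫⁻ t, f t ∂(ω x (φ y)) ∂m = ∫⁻ t, f t ∂m)
    {N : Set K} (hN : m N = 0) : ∀ᵐ y ∂m, ω x (φ y) N = 0 := by
  refine ae_measure_eq_zero (fun f => (continuous_lintegral_ω f).comp
    (continuous_const.prodMk hφ)) (fun C hC => ?_) (fun f => (h f).le) hN
  obtain ⟨L, hL, hCL⟩ := exists_isCompact_support_subset
    ((isCompact_singleton (x := x)).prod (hC.image hφ))
  exact ⟨L, hL, fun y hy => (ae_mem_support x (φ y)).mono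
    fun t ht => hCL (x, φ y) ⟨rfl, Set.mem_image_of_mem φ hy⟩ ht⟩

theorem IsHaarMeasure.translate_ae_eq (hm : IsHaarMeasure m) (h : f =ᵐ[m] g) (x : K) :
    translate x f =ᵐ[m] translate x g := by
  have := hm.isFiniteMeasureOnCompacts
  have := hm.innerRegular
  filter_upwards [ae_ω_eq_zero_of_continuous continuous_id (fun f => hm.lintegral_lintegral_ω f x)
    (ae_iff.1 h)] with y hy
  exact integral_congr_ae (ae_iff.2 hy)

theorem IsHaarMeasure.translate_tilde_ae_eq (hm : IsHaarMeasure m) (h : f =ᵐ[m] g)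
    (hK : IsCommutative K) (x : K) :
    ∀ᵐ y ∂m, translate (tilde y) f x = translate (tilde y) g x := by
  have := hm.isFiniteMeasureOnCompacts
  have := hm.innerRegular
  have hinv (f : C_c(K, ℝ≥0)) : ∫⁻ y, ∫⁻ t, f t ∂(ω x (tilde y)) ∂m = ∫⁻ t, f t ∂m :=
    lintegral_lintegral_eq_of_integral_eq (reflect (translateCc x (toComplexCc f))).integrable
      ((integral_reflect hK hm (translateCc x (toComplexCc f))).trans (hm.integral_translate x _
        (toComplexCc f).continuous (toComplexCc f).hasCompactSupport))
  filter_upwards [ae_ω_eq_zero_of_continuous continuous_tilde hinv (ae_iff.1 h)] with y hy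
  rw [translate_comm hK f, translate_comm hK g]
  exact integral_congr_ae (ae_iff.2 hy)

theorem IsHaarMeasure.convolution_congr (hm : IsHaarMeasure m) (hK : IsCommutative K)
    (hf : f =ᵐ[m] f') (hg : g =ᵐ[m] g') : convolution m f g = convolution m f' g' := by
  ext x
  refine integral_congr_ae ?_
  filter_upwards [hf, hm.translate_tilde_ae_eq hg hK x] with y hfy hgy
  rw [hfy, hgy]

theorem convolution_translate_left (hK : IsCommutative K) (hm : IsHaarMeasure m) (f : C_c(K, ℂ))
    (hg : Continuous g) (x : K) :
    convolution m (translate x f) g = convolution m f (translate x g) := by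
  ext z
  have hcont : Continuous (translate z g ∘ tilde) :=
    (continuous_translate hg).comp (continuous_const.prodMk continuous_tilde)
  calc ∫ y, translate x f y * translate (tilde y) g z ∂m
      = ∫ y, translate x f y * (translate z g ∘ tilde) y ∂m := by
        simp only [translate_comm hK g _ z, Function.comp_apply]
    _ = ∫ y, f y * translate (tilde x) (translate z g ∘ tilde) y ∂m :=
        integral_translate_mul hK hm f hcont x
    _ = ∫ y, f y * translate (tilde y) (translate x g) z ∂m := by
        simp only [translate_comp_tilde hK, tilde_tilde, translate_translate_comm hK hg x z,
          translate_comm hK (translate x g) z]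

/-- The convolution of two functions in `C_c(K)`, as an element of `C_c(K)`. -/
noncomputable def convolutionCc (m : Measure K) [IsFiniteMeasureOnCompacts m] (f g : C_c(K, ℂ)) :
    C_c(K, ℂ) :=
  ((isContinuousFamily_translateCc g).comp continuous_tilde).integral f m

theorem coe_convolutionCc [IsFiniteMeasureOnCompacts m] (f g : C_c(K, ℂ)) :
    ⇑(convolutionCc m f g) = convolution m f g := rfl

theorem convolutionCc_translateCc_left [IsFiniteMeasureOnCompacts m] (hK : IsCommutative K)
    (hm : IsHaarMeasure m) (f g : C_c(K, ℂ)) (x : K) :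
    convolutionCc m (translateCc x f) g = convolutionCc m f (translateCc x g) :=
  DFunLike.coe_injective (convolution_translate_left hK hm f g.continuous x)

end Convolution

section Character

variable {α : K →ᵇ ℂ}

namespace IsCharacter

theorem apply_e_ne_zero (hα : IsCharacter α) : α e ≠ 0 := by
  refine fun h => hα.ne_zero (BoundedContinuousFunction.ext fun x => ?_)
  simpa [ω_e, h] using hα.integral_ω x e

theorem translate_conj (hα : IsCharacter α) (x y : K) :
    translate (tilde x) (fun z => conj (α z)) y = α x * conj (α y) := by
  rw [translate, integral_conj, hα.integral_ω, hα.map_tilde, map_mul, Complex.conj_conj]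

theorem fourier_translate (hα : IsCharacter α) (hK : IsCommutative K) (hm : IsHaarMeasure m)
    (f : C_c(K, ℂ)) (x : K) :
    fourier m (translate x f) α = α x * fourier m f α := by
  have hconj : Continuous fun z => conj (α z) := by fun_prop
  calc ∫ y, conj (α y) * translate x f y ∂m
      = ∫ y, translate x f y * conj (α y) ∂m := by simp only [mul_comm]
    _ = ∫ y, f y * (α x * conj (α y)) ∂m := by
        simp only [integral_translate_mul hK hm f hconj x, hα.translate_conj]
    _ = α x * ∫ y, conj (α y) * f y ∂m := by
        simp only [← integral_const_mul, mul_comm, mul_left_comm]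

theorem exists_fourier_eq_one (hα : IsCharacter α) (hm : IsHaarMeasure m) :
    ∃ g : C_c(K, ℂ), fourier m g α = 1 := by
  have := hm.isFiniteMeasureOnCompacts
  have := hm.isOpenPosMeasure
  obtain ⟨χ, hχ, -⟩ := exists_compactlySupported_eq_one (isCompact_singleton (x := (e : K)))
    isOpen_univ (Set.subset_univ _)
  let g : C_c(K, ℂ) := ⟨⟨fun x => α x * toComplexCc χ x, by fun_prop⟩,
    (toComplexCc χ).hasCompactSupport.mul_left⟩
  have hg : fourier m g α = ((∫ x, ‖α x‖ ^ 2 * χ x ∂m : ℝ) : ℂ) := by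
    rw [← integral_complex_ofReal]
    refine integral_congr_ae (.of_forall fun x => ?_)
    change conj (α x) * (α x * χ x) = ((‖α x‖ ^ 2 * χ x : ℝ) : ℂ)
    rw [← mul_assoc, Complex.conj_mul', Complex.ofReal_mul, Complex.ofReal_pow]
  have hpos : 0 < ∫ x, ‖α x‖ ^ 2 * χ x ∂m := by
    refine Continuous.integral_pos_of_hasCompactSupport_nonneg_nonzero (x := e) (by fun_prop) ?_
      (fun x => by positivity) (by simp [hχ e rfl, hα.apply_e_ne_zero])
    exact (χ.hasCompactSupport.comp_left (g := ((↑) : ℝ≥0 → ℝ)) rfl).mul_left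
  refine ⟨(fourier m g α)⁻¹ • g, ?_⟩
  calc ∫ x, conj (α x) * ((fourier m g α)⁻¹ * g x) ∂m
      = (fourier m g α)⁻¹ * fourier m g α := by
        simp only [mul_left_comm (conj _), integral_const_mul, fourier]
    _ = 1 := inv_mul_cancel₀ (by rw [hg]; exact Complex.ofReal_ne_zero.2 hpos.ne')

end IsCharacter

end Character

section Derivation

variable {α : K →ᵇ ℂ} {D : StrongDual ℂ (Lp ℂ 1 m)}

/-- The `α`-mean `M` turns the equation into `α(x) M(φ) = α(x) M(φ) + φ(x)`. -/
theorem IsAmenable.eq_zero_of_translate_eq_add (hamen : IsAmenable m α) (hm : IsHaarMeasure m)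
    {φ : K →ᵇ ℂ} (hφ : ∀ x y, translate x φ y = α x * φ y + φ x * α y) : φ = 0 := by
  obtain ⟨M, hMα, hM⟩ := hamen
  have hcoe (f : K →ᵇ ℂ) : toLinfty m f =ᵐ[m] f := MemLp.coeFn_toLp _
  ext x
  have htranslate : ⇑(α x • toLinfty m φ + φ x • toLinfty m α)
      =ᵐ[m] translate x (toLinfty m φ) := by
    refine EventuallyEq.trans ?_ (hm.translate_ae_eq (hcoe φ) x).symm
    filter_upwards [Lp.coeFn_add (α x • toLinfty m φ) (φ x • toLinfty m α),
      Lp.coeFn_smul (α x) (toLinfty m φ), Lp.coeFn_smul (φ x) (toLinfty m α), hcoe φ, hcoe α]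
      with y hadd hsmulφ hsmulα hyφ hyα
    simp only [hadd, Pi.add_apply, hsmulφ, hsmulα, Pi.smul_apply, hyφ, hyα, hφ, smul_eq_mul]
  have h := hM x _ _ htranslate
  rw [map_add, map_smul, map_smul, hMα, smul_eq_mul, smul_eq_mul, mul_one] at h
  exact add_eq_left.1 h

variable [IsFiniteMeasureOnCompacts m]

theorem IsDerivation.apply_convolutionCc (hD : IsDerivation m α D) (hK : IsCommutative K)
    (hm : IsHaarMeasure m) (f g : C_c(K, ℂ)) :
    D (toL1 m (convolutionCc m f g)) =
      fourier m f α * D (toL1 m g) + fourier m g α * D (toL1 m f) := by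
  have h := hD (toL1 m f) (toL1 m g) (toL1 m (convolutionCc m f g)) (by
    rw [hm.convolution_congr hK (coeFn_toL1 m f) (coeFn_toL1 m g), ← coe_convolutionCc]
    exact coeFn_toL1 m _)
  rwa [fourier_congr (coeFn_toL1 m f), fourier_congr (coeFn_toL1 m g)] at h

theorem IsDerivation.apply_translateCc (hD : IsDerivation m α D) (hK : IsCommutative K)
    (hm : IsHaarMeasure m) (hα : IsCharacter α) (f : C_c(K, ℂ)) {g : C_c(K, ℂ)}
    (hg : fourier m g α = 1) (x : K) :
    D (toL1 m (translateCc x f)) = α x * D (toL1 m f) +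
      fourier m f α * (D (toL1 m (translateCc x g)) - α x * D (toL1 m g)) := by
  have h := congrArg (fun u => D (toL1 m u)) (convolutionCc_translateCc_left hK hm f g x)
  simp only [hD.apply_convolutionCc hK hm, coe_translateCc, hα.fourier_translate hK hm, hg] at h
  linear_combination h

theorem apply_translateCc_translateCc (D : StrongDual ℂ (Lp ℂ 1 m)) (g : C_c(K, ℂ)) (x y : K) :
    D (toL1 m (translateCc y (translateCc x g))) =
      ∫ t, D (toL1 m (translateCc t g)) ∂(ω x y) := by
  obtain ⟨χ, hχ⟩ := exists_compactlySupported_eqOn (continuous_const (y := (1 : ℂ)))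
    (isCompact_support_ω x y)
  have hmul (u : K → ℂ) : ∫ t, χ t * u t ∂(ω x y) = ∫ t, u t ∂(ω x y) :=
    integral_congr_ae ((ae_mem_support x y).mono fun t ht => by simp [hχ ht])
  have heq : translateCc y (translateCc x g) =
      (isContinuousFamily_translateCc g).integral χ (ω x y) := by
    ext z
    exact (translate_translate g.continuous y x z).trans (hmul _).symm
  rw [heq, IsContinuousFamily.apply_toL1_integral, hmul]

theorem exists_boundedContinuous_eq_apply_translateCc (D : StrongDual ℂ (Lp ℂ 1 m))
    (hm : IsHaarMeasure m) (g : C_c(K, ℂ)) :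
    ∃ ψ : K →ᵇ ℂ, ∀ x, ψ x = D (toL1 m (translateCc x g)) := by
  refine ⟨.ofNormedAddCommGroup (fun x => D (toL1 m (translateCc x g)))
    (D.continuous.comp ((isContinuousFamily_translateCc g).continuous_toL1 m))
    (‖D‖ * ∫ y, ‖g y‖ ∂m) fun x => ?_, fun x => rfl⟩
  refine (D.le_opNorm _).trans ?_
  rw [norm_toL1]
  exact mul_le_mul_of_nonneg_left (hm.integral_norm_translate_le x g) (norm_nonneg _)

theorem IsDerivation.apply_translateCc_eq_mul (hD : IsDerivation m α D) (hK : IsCommutative K)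
    (hm : IsHaarMeasure m) (hα : IsCharacter α) (hamen : IsAmenable m α) {g : C_c(K, ℂ)}
    (hg : fourier m g α = 1) (x : K) :
    D (toL1 m (translateCc x g)) = α x * D (toL1 m g) := by
  obtain ⟨ψ, hψ⟩ := exists_boundedContinuous_eq_apply_translateCc D hm g
  have hφ (x y : K) : translate x (ψ - D (toL1 m g) • α : K →ᵇ ℂ) y =
      α x * (ψ - D (toL1 m g) • α) y + (ψ - D (toL1 m g) • α) x * α y := by
    have htranslate : translate x (ψ - D (toL1 m g) • α : K →ᵇ ℂ) y =
        D (toL1 m (translateCc y (translateCc x g))) - D (toL1 m g) * (α x * α y) := by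
      rw [apply_translateCc_translateCc, ← hα.integral_ω, ← integral_const_mul,
        ← integral_congr_ae (.of_forall hψ)]
      exact integral_sub (integrable_ω ψ.continuous x y)
        ((integrable_ω α.continuous x y).const_mul _)
    rw [htranslate, hD.apply_translateCc hK hm hα (translateCc x g) hg, coe_translateCc,
      hα.fourier_translate hK hm, hg]
    simp only [BoundedContinuousFunction.coe_sub, BoundedContinuousFunction.coe_smul, Pi.sub_apply,
      hψ, smul_eq_mul]
    ring
  have h := DFunLike.congr_fun (hamen.eq_zero_of_translate_eq_add hm hφ) x
  simp only [BoundedContinuousFunction.coe_sub, BoundedContinuousFunction.coe_smul, Pi.sub_apply,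
    hψ, smul_eq_mul, BoundedContinuousFunction.coe_zero, Pi.zero_apply] at h
  linear_combination h

theorem apply_convolutionCc_of_apply_translateCc (hα : IsCharacter α) (f : C_c(K, ℂ))
    {g : C_c(K, ℂ)} (h : ∀ x, D (toL1 m (translateCc x g)) = α x * D (toL1 m g)) :
    D (toL1 m (convolutionCc m f g)) = fourier m f α * D (toL1 m g) := by
  rw [convolutionCc, IsContinuousFamily.apply_toL1_integral, fourier, ← integral_mul_const]
  simp only [h, hα.map_tilde, mul_left_comm, mul_assoc]

theorem IsDerivation.apply_toL1_eq_zero (hD : IsDerivation m α D) (hK : IsCommutative K)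
    (hm : IsHaarMeasure m) (hα : IsCharacter α) (hamen : IsAmenable m α) (f : C_c(K, ℂ)) :
    D (toL1 m f) = 0 := by
  obtain ⟨g, hg⟩ := hα.exists_fourier_eq_one hm
  have h := apply_convolutionCc_of_apply_translateCc hα f
    (hD.apply_translateCc_eq_mul hK hm hα hamen hg)
  rwa [hD.apply_convolutionCc hK hm, hg, one_mul, add_eq_left] at h

end Derivation

end Hypergroup

theorem mainTheorem9 {K : Type*} [TopologicalSpace K] [T2Space K] [LocallyCompactSpace K]
    [MeasurableSpace K] [BorelSpace K] [Hypergroup K]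
    (hK : Hypergroup.IsCommutative K)
    (m : Measure K) (hm : Hypergroup.IsHaarMeasure m)
    (α : K →ᵇ ℂ) (hα : Hypergroup.IsCharacter α)
    (hamen : Hypergroup.IsAmenable m α)
    (D : StrongDual ℂ (Lp ℂ 1 m)) (hD : Hypergroup.IsDerivation m α D) :
    D = 0 := by
  have := hm.isFiniteMeasureOnCompacts
  have := hm.innerRegular
  refine DFunLike.coe_injective ((denseRange_toL1 m).equalizer D.continuous continuous_const ?_)
  exact funext fun f => hD.apply_toL1_eq_zero hK hm hα hamen f
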